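/- Let $m,p\ge 1$, $n=m+p$, and let $\Lambda=\mathrm{diag}(\lambda_1,\dots,\lambda_n)$ with $\lambda_i$ Lipschitz on $[0,1]$ and $$\lambda_1(x)<\cdots<\lambda_m(x)<0<\lambda_{m+1}(x)<\cdots<\lambda_{m+p}(x)\qquad\text{for all } x\in[0,1].$$ Extend the $\lambda_i$ to Lipschitz functions on $\mathbb R$ that keep this ordering and stay bounded away from $0$ (nothing below depends on the extension; one may take each $\lambda_i$ constant on each side of $[0,1]$). Put $T_i(\Lambda)=\int_0^1 \frac{d\xi}{|\lambda_i(\xi)|}$, and let $\zeta_{ij}$ be the solution of $\zeta_{ij}'(s)=\lambda_j(\zeta_{ij}(s))/\lambda_i(s)$, $\zeta_{ij}(0)=0$. A matrix $Q^0\in\mathbb R^{p\times m}$ is in canonical form if, for some $\rho\ge 0$, some rows $r_1<\cdots<r_\rho$ and some distinct columns $c_1,\dots,c_\rho$, its entries are $1$ at the positions $(r_k,c_k)$ and $0$ elsewhere. An LCU decomposition of $Q\in\mathbb R^{p\times m}$ consists of an invertible lower triangular matrix $L\in\mathbb R^{p\times p}$ and an upper triangular matrix $U\in\mathbb R^{m\times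 m}$ with ones on its diagonal such that $Q^0=LQU$ is in canonical form. The matrix $Q^0$ is uniquely determined by $Q$ and is called the canonical form of $Q$. Let $Q\in\mathbb R^{p\times m}$ be arbitrary, let $(r_1,c_1),\dots,(r_\rho,c_\rho)$ be the positions of the nonzero entries of the canonical form of $Q$, and let $T$ satisfy $$T\ \ge\ \max\Big\{\max_{1\le k\le \rho}\big(T_{m+r_k}(\Lambda)+T_{c_k}(\Lambda)\big),\ T_{m+1}(\Lambda),\ T_m(\Lambda)\Big\}$$ (the first term is omitted if $\rho=0$). Consider the system $$\partial_t y+\Lambda(x)\,\partial_x y=0,\qquad y_-(t,1)=u(t),\quad y_+(t,0)=Q\,y_-(t,0),\qquad y(0,\cdot)=y^0,$$ for $t>0$, $x\in(0,1)$, where $y_-=(y_1,\dots,y_m)$ and $y_+=(y_{m+1},\dots,y_n)$. Solutions on $(0,S)$ are understood along the characteristics, in the class $C^0([0,S];L^2(0,1)^n)\cap C^0([0,1];L^2(0,S)^n)$. Then $Q$ has an LCU decomposition and, for every matrix $U$ coming from an LCU decomposition of $Q$, with $U^{-1}=(u^{ik})_{1\le i,k\le m}$, the feedback law $$u_i(t)=-\sum_{k=i+1}^m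 u^{ik}\,y_k\big(t,\zeta_{ik}(1)\big),\qquad i\in\{1,\dots,m\},$$ stabilizes the system in finite time with settling time $T$: for every $y^0\in L^2(0,1)^n$ and every $S>0$ the closed-loop system has exactly one solution on $(0,S)$, and this solution satisfies $y(t,\cdot)=0$ for every $t\in[T,S]$ (in particular $y(T,\cdot)=0$). -/

import Mathlib

open MeasureTheory Set Filter Topology

namespace Hyperbolic

/-- Equations (components of the state) are indexed by `Fin m ⊕ Fin p`: `inl i` is the component
number `i + 1` (negative speed), `inr i` is the component number `m + i + 1` (positive speed). -/
abbrev Idx (m p : ℕ) : Type := Fin m ⊕ Fin p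

/-- The assumptions on the speeds: each `λ_i` is Lipschitz on `[0,1]`, and
`λ_1(x) < ⋯ < λ_m(x) < 0 < λ_{m+1}(x) < ⋯ < λ_{m+p}(x)` for every `x ∈ [0,1]`. -/
structure IsSpeeds {m p : ℕ} (lam : Idx m p → ℝ → ℝ) : Prop where
  lipschitz : ∀ i, ∃ K : NNReal, LipschitzOnWith K (lam i) (Icc 0 1)
  neg : ∀ i : Fin m, ∀ x ∈ Icc (0 : ℝ) 1, lam (Sum.inl i) x < 0
  pos : ∀ i : Fin p, ∀ x ∈ Icc (0 : ℝ) 1, 0 < lam (Sum.inr i) x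
  strictMono_neg : ∀ x ∈ Icc (0 : ℝ) 1, StrictMono fun i : Fin m => lam (Sum.inl i) x
  strictMono_pos : ∀ x ∈ Icc (0 : ℝ) 1, StrictMono fun i : Fin p => lam (Sum.inr i) x

/-! ### Speeds, travel times and characteristics -/

section Characteristics

variable {m p : ℕ}

/-- The extension of the speeds from `[0,1]` to `ℝ`, constant on each side of `[0,1]`. -/
noncomputable def speedExt (lam : Idx m p → ℝ → ℝ) (i : Idx m p) (x : ℝ) : ℝ :=
  lam i (projIcc (0 : ℝ) 1 zero_le_one x)

/-- The time `T_i(Λ) = ∫_0^1 dξ / |λ_i(ξ)|` needed to cross the domain at speed `λ_i`. -/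
noncomputable def travelTime (lam : Idx m p → ℝ → ℝ) : Idx m p → ℝ
  | Sum.inl i => ∫ ξ in (0 : ℝ)..1, 1 / (-lam (Sum.inl i) ξ)
  | Sum.inr i => ∫ ξ in (0 : ℝ)..1, 1 / lam (Sum.inr i) ξ

/-- `γ` is the solution on `ℝ` of `γ'(s) = λ_i(γ(s))`, `γ(t) = x`. -/
def IsCharacteristic (lam : Idx m p → ℝ → ℝ) (i : Idx m p) (t x : ℝ) (γ : ℝ → ℝ) : Prop :=
  γ t = x ∧ ∀ s, HasDerivAt γ (speedExt lam i (γ s)) s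

/-- The flow `χ_i(s; t, x)` of the speed `λ_i`, that is, the value at time `s` of the
characteristic through `(t, x)`; see `isCharacteristic_characteristic` and
`IsCharacteristic.unique` for existence and uniqueness. -/
noncomputable def characteristic (lam : Idx m p → ℝ → ℝ) (i : Idx m p) (s t x : ℝ) : ℝ :=
  Classical.epsilon (IsCharacteristic lam i t x) s

/-- The time at which the characteristic `s ↦ χ_i(s; t, x)` enters the domain, through `x = 1`
for negative speeds and through `x = 0` for positive speeds; see
`characteristic_entryTime_neg` and `characteristic_entryTime_pos`. -/
noncomputable def entryTime (lam : Idx m p → ℝ → ℝ) : Idx m p → ℝ → ℝ → ℝ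
  | Sum.inl i, t, x => t - ∫ ξ in x..1, 1 / (-speedExt lam (Sum.inl i) ξ)
  | Sum.inr i, t, x => t - ∫ ξ in (0 : ℝ)..x, 1 / speedExt lam (Sum.inr i) ξ

/-- `γ` is the solution on `ℝ` of `γ'(s) = λ_j(γ(s)) / λ_i(s)`, `γ(0) = 0`. -/
def IsZeta (lam : Idx m p → ℝ → ℝ) (i j : Idx m p) (γ : ℝ → ℝ) : Prop :=
  γ 0 = 0 ∧ ∀ s, HasDerivAt γ (speedExt lam j (γ s) / speedExt lam i s) s

/-- The function `ζ_{ij}`; see `isZeta_zeta` and `IsZeta.unique`. -/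
noncomputable def zeta (lam : Idx m p → ℝ → ℝ) (i j : Idx m p) : ℝ → ℝ :=
  Classical.epsilon (IsZeta lam i j)

/-- An autonomous equation `γ' = f(γ)` with `f` continuous, bounded, and bounded away from zero:
primitives of `1/f`, which are inverse to solutions. -/
theorem exists_flow_of_pos {f : ℝ → ℝ} (hf : Continuous f) {a b : ℝ} (ha : 0 < a)
    (hfa : ∀ x, a ≤ f x) (hfb : ∀ x, f x ≤ b) (t x : ℝ) :
    ∃ γ : ℝ → ℝ, γ t = x ∧ ∀ s, HasDerivAt γ (f (γ s)) s := by
  have hpos : ∀ x, 0 < f x := fun x => ha.trans_le (hfa x)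
  have hb : 0 < b := (hpos 0).trans_le (hfb 0)
  have hc : Continuous fun ξ => 1 / f ξ := continuous_const.div hf fun x => (hpos x).ne'
  set G : ℝ → ℝ := fun θ => t + ∫ ξ in x..θ, 1 / f ξ with hG
  have hd : ∀ θ, HasDerivAt G (1 / f θ) θ := fun θ =>
    (hc.integral_hasStrictDerivAt x θ).hasDerivAt.const_add t
  have hmono : StrictMono G := strictMono_of_deriv_pos fun θ => by
    rw [(hd θ).deriv]; exact one_div_pos.2 (hpos θ)
  have hGx : G x = t := by simp [hG]
  have hdiff : Differentiable ℝ fun θ => G θ - b⁻¹ * θ := fun θ =>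
    (hd θ).differentiableAt.sub (by fun_prop)
  have hM : Monotone fun θ => G θ - b⁻¹ * θ := monotone_of_deriv_nonneg hdiff fun θ => by
    have h := ((hd θ).sub ((hasDerivAt_id θ).const_mul b⁻¹)).deriv
    have h2 : deriv (fun θ => G θ - b⁻¹ * θ) θ = 1 / f θ - b⁻¹ * 1 := h
    rw [h2, mul_one, ← one_div, sub_nonneg]
    exact one_div_le_one_div_of_le (hpos θ) (hfb θ)
  have hbi : 0 < b⁻¹ := inv_pos.2 hb
  have htop : Tendsto G atTop atTop := by
    refine tendsto_atTop_mono' _ (f₁ := fun θ => (G 0) + b⁻¹ * θ) ?_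
      (tendsto_atTop_add_const_left _ _ (tendsto_id.const_mul_atTop hbi))
    filter_upwards [eventually_ge_atTop 0] with θ hθ
    have := hM hθ
    simp only [mul_zero, sub_zero] at this
    linarith
  have hbot : Tendsto G atBot atBot := by
    refine tendsto_atBot_mono' _ (f₁ := fun θ => (G 0) + b⁻¹ * θ) ?_
      (tendsto_atBot_add_const_left _ _ (tendsto_id.const_mul_atBot hbi))
    filter_upwards [eventually_le_atBot 0] with θ hθ
    have := hM hθ
    simp only [mul_zero, sub_zero] at this
    linarith
  have hcont : Continuous G := continuous_iff_continuousAt.2 fun θ => (hd θ).continuousAt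
  have hsurj : Function.Surjective G := hcont.surjective htop hbot
  let e : ℝ ≃o ℝ := hmono.orderIsoOfSurjective G hsurj
  have hes : ∀ s, G (e.symm s) = s := fun s => e.apply_symm_apply s
  refine ⟨e.symm, ?_, fun s => ?_⟩
  · rw [← hGx]; exact e.symm_apply_apply x
  · have := HasDerivAt.of_local_left_inverse (f := G) (g := e.symm) (a := s)
      e.symm.continuous.continuousAt (hd (e.symm s)) (one_div_pos.2 (hpos _)).ne'
      (Eventually.of_forall hes)
    simpa using this

theorem exists_flow_of_neg {f : ℝ → ℝ} (hf : Continuous f) {a b : ℝ} (ha : 0 < a)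
    (hfa : ∀ x, a ≤ -f x) (hfb : ∀ x, -f x ≤ b) (t x : ℝ) :
    ∃ γ : ℝ → ℝ, γ t = x ∧ ∀ s, HasDerivAt γ (f (γ s)) s := by
  obtain ⟨γ, h1, h2⟩ := exists_flow_of_pos (f := fun z => -f z) hf.neg ha hfa hfb (-t) x
  refine ⟨fun s => γ (-s), h1, fun s => ?_⟩
  have := (h2 (-s)).comp s (hasDerivAt_neg s)
  simpa [Function.comp_def] using this

theorem IsSpeeds.continuous_speedExt {lam : Idx m p → ℝ → ℝ} (h : IsSpeeds lam) (i : Idx m p) :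
    Continuous (speedExt lam i) := by
  obtain ⟨K, hK⟩ := h.lipschitz i
  exact hK.continuousOn.comp_continuous (continuous_subtype_val.comp continuous_projIcc)
    fun x => (projIcc (0 : ℝ) 1 zero_le_one x).2

theorem IsSpeeds.speedExt_neg {lam : Idx m p → ℝ → ℝ} (h : IsSpeeds lam) (i : Fin m) (x : ℝ) :
    speedExt lam (Sum.inl i) x < 0 := h.neg i _ (projIcc (0 : ℝ) 1 zero_le_one x).2

theorem IsSpeeds.speedExt_pos {lam : Idx m p → ℝ → ℝ} (h : IsSpeeds lam) (i : Fin p) (x : ℝ) :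
    0 < speedExt lam (Sum.inr i) x := h.pos i _ (projIcc (0 : ℝ) 1 zero_le_one x).2

theorem IsSpeeds.speedExt_ne_zero {lam : Idx m p → ℝ → ℝ} (h : IsSpeeds lam) (i : Idx m p)
    (x : ℝ) : speedExt lam i x ≠ 0 := by
  cases i with
  | inl i => exact (h.speedExt_neg i x).ne
  | inr i => exact (h.speedExt_pos i x).ne'

theorem IsSpeeds.exists_bounds {lam : Idx m p → ℝ → ℝ} (h : IsSpeeds lam) (i : Idx m p) :
    ∃ a b : ℝ, 0 < a ∧ ∀ x, a ≤ |speedExt lam i x| ∧ |speedExt lam i x| ≤ b := by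
  have hc : ContinuousOn (fun x => |speedExt lam i x|) (Icc 0 1) :=
    (h.continuous_speedExt i).abs.continuousOn
  obtain ⟨x₀, -, h₀⟩ := isCompact_Icc.exists_isMinOn (nonempty_Icc.2 zero_le_one) hc
  obtain ⟨x₁, -, h₁⟩ := isCompact_Icc.exists_isMaxOn (nonempty_Icc.2 zero_le_one) hc
  refine ⟨_, |speedExt lam i x₁|, abs_pos.2 (h.speedExt_ne_zero i x₀), fun x => ?_⟩
  have hx : speedExt lam i x = speedExt lam i (projIcc (0 : ℝ) 1 zero_le_one x) := by
    simp [speedExt]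
  rw [hx]
  exact ⟨h₀ (projIcc (0 : ℝ) 1 zero_le_one x).2, h₁ (projIcc (0 : ℝ) 1 zero_le_one x).2⟩

theorem IsSpeeds.exists_isCharacteristic {lam : Idx m p → ℝ → ℝ} (h : IsSpeeds lam)
    (i : Idx m p) (t x : ℝ) : ∃ γ, IsCharacteristic lam i t x γ := by
  obtain ⟨a, b, ha, hab⟩ := h.exists_bounds i
  cases i with
  | inl i =>
    have e : ∀ x, |speedExt lam (Sum.inl i) x| = -speedExt lam (Sum.inl i) x := fun x =>
      abs_of_neg (h.speedExt_neg i x)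
    exact exists_flow_of_neg (h.continuous_speedExt _) ha (fun x => e x ▸ (hab x).1)
      (fun x => e x ▸ (hab x).2) t x
  | inr i =>
    have e : ∀ x, |speedExt lam (Sum.inr i) x| = speedExt lam (Sum.inr i) x := fun x =>
      abs_of_pos (h.speedExt_pos i x)
    exact exists_flow_of_pos (h.continuous_speedExt _) ha (fun x => e x ▸ (hab x).1)
      (fun x => e x ▸ (hab x).2) t x

/-- The function `characteristic lam i · t x` is a solution of its defining problem. -/
theorem isCharacteristic_characteristic {lam : Idx m p → ℝ → ℝ} (h : IsSpeeds lam)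
    (i : Idx m p) (t x : ℝ) :
    IsCharacteristic lam i t x fun s => characteristic lam i s t x :=
  Classical.epsilon_spec (h.exists_isCharacteristic i t x)

theorem IsSpeeds.hasDerivAt_primitive {lam : Idx m p → ℝ → ℝ} (h : IsSpeeds lam) (i : Idx m p)
    (x θ : ℝ) : HasDerivAt (fun θ => ∫ ξ in x..θ, 1 / speedExt lam i ξ)
      (1 / speedExt lam i θ) θ :=
  ((continuous_const.div (h.continuous_speedExt i)
    (h.speedExt_ne_zero i)).integral_hasStrictDerivAt x θ).hasDerivAt

theorem IsSpeeds.primitive_injective {lam : Idx m p → ℝ → ℝ} (h : IsSpeeds lam) (i : Idx m p)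
    (x : ℝ) : Function.Injective fun θ => ∫ ξ in x..θ, 1 / speedExt lam i ξ := by
  cases i with
  | inl i =>
    exact (strictAnti_of_deriv_neg fun θ => by
      rw [(h.hasDerivAt_primitive (Sum.inl i) x θ).deriv]
      exact one_div_neg.2 (h.speedExt_neg i θ)).injective
  | inr i =>
    exact (strictMono_of_deriv_pos fun θ => by
      rw [(h.hasDerivAt_primitive (Sum.inr i) x θ).deriv]
      exact one_div_pos.2 (h.speedExt_pos i θ)).injective

/-- Separation of variables along a characteristic. -/
theorem IsCharacteristic.integral_eq {lam : Idx m p → ℝ → ℝ} (h : IsSpeeds lam) {i : Idx m p}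
    {t x : ℝ} {γ : ℝ → ℝ} (hγ : IsCharacteristic lam i t x γ) (s : ℝ) :
    ∫ ξ in x..γ s, 1 / speedExt lam i ξ = s - t := by
  have hd : ∀ s, HasDerivAt (fun s => (∫ ξ in x..γ s, 1 / speedExt lam i ξ) - s) 0 s := by
    intro s
    have := ((h.hasDerivAt_primitive i x (γ s)).comp s (hγ.2 s)).sub (hasDerivAt_id s)
    rw [one_div_mul_cancel (h.speedExt_ne_zero i _), sub_self] at this
    exact this
  have := is_const_of_deriv_eq_zero (fun s => (hd s).differentiableAt) (fun s => (hd s).deriv) s t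
  simp only [hγ.1, intervalIntegral.integral_same] at this
  linarith

/-- Uniqueness of the characteristic through `(t, x)`. -/
theorem IsCharacteristic.unique {lam : Idx m p → ℝ → ℝ} (h : IsSpeeds lam) {i : Idx m p}
    {t x : ℝ} {γ δ : ℝ → ℝ} (hγ : IsCharacteristic lam i t x γ)
    (hδ : IsCharacteristic lam i t x δ) : γ = δ :=
  funext fun s => h.primitive_injective i x ((hγ.integral_eq h s).trans (hδ.integral_eq h s).symm)

theorem characteristic_entryTime_neg {lam : Idx m p → ℝ → ℝ} (h : IsSpeeds lam) (i : Fin m)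
    (t x : ℝ) :
    characteristic lam (Sum.inl i) (entryTime lam (Sum.inl i) t x) t x = 1 := by
  apply h.primitive_injective (Sum.inl i) x
  refine ((isCharacteristic_characteristic h (Sum.inl i) t x).integral_eq h _).trans ?_
  simp only [entryTime, one_div, inv_neg, intervalIntegral.integral_neg]
  ring

theorem characteristic_entryTime_pos {lam : Idx m p → ℝ → ℝ} (h : IsSpeeds lam) (i : Fin p)
    (t x : ℝ) :
    characteristic lam (Sum.inr i) (entryTime lam (Sum.inr i) t x) t x = 0 := by
  apply h.primitive_injective (Sum.inr i) x
  refine ((isCharacteristic_characteristic h (Sum.inr i) t x).integral_eq h _).trans ?_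
  simp only [entryTime]
  rw [intervalIntegral.integral_symm 0 x]
  ring

/-- The function `zeta lam i j` is a solution of its defining problem. -/
theorem isZeta_zeta {lam : Idx m p → ℝ → ℝ} (h : IsSpeeds lam) (i j : Idx m p) :
    IsZeta lam i j (zeta lam i j) := by
  refine Classical.epsilon_spec (p := IsZeta lam i j) ?_
  obtain ⟨γ, h1, h2⟩ := h.exists_isCharacteristic j 0 0
  refine ⟨fun s => γ (∫ ξ in (0 : ℝ)..s, 1 / speedExt lam i ξ), by simp [h1], fun s => ?_⟩
  have := (h2 (∫ ξ in (0 : ℝ)..s, 1 / speedExt lam i ξ)).comp s (h.hasDerivAt_primitive i 0 s)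
  rwa [mul_one_div] at this

/-- Uniqueness of the function `ζ_{ij}`. -/
theorem IsZeta.unique {lam : Idx m p → ℝ → ℝ} (h : IsSpeeds lam) {i j : Idx m p}
    {γ δ : ℝ → ℝ} (hγ : IsZeta lam i j γ) (hδ : IsZeta lam i j δ) : γ = δ := by
  have key : ∀ {γ : ℝ → ℝ}, IsZeta lam i j γ → ∀ s, (∫ ξ in (0 : ℝ)..γ s, 1 / speedExt lam j ξ) =
      ∫ ξ in (0 : ℝ)..s, 1 / speedExt lam i ξ := by
    intro γ hγ s
    have hd : ∀ s, HasDerivAt (fun s => (∫ ξ in (0 : ℝ)..γ s, 1 / speedExt lam j ξ) -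
        ∫ ξ in (0 : ℝ)..s, 1 / speedExt lam i ξ) 0 s := by
      intro s
      have := ((h.hasDerivAt_primitive j 0 (γ s)).comp s (hγ.2 s)).sub
        (h.hasDerivAt_primitive i 0 s)
      rw [mul_div_assoc', one_div_mul_cancel (h.speedExt_ne_zero j _), sub_self] at this
      exact this
    have := is_const_of_deriv_eq_zero (fun s => (hd s).differentiableAt)
      (fun s => (hd s).deriv) s 0
    simp only [hγ.1, intervalIntegral.integral_same, sub_zero] at this
    linarith
  exact funext fun s => h.primitive_injective j 0 ((key hγ s).trans (key hδ s).symm)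

end Characteristics

/-! ### The decomposition of the boundary coupling matrix -/

section LCU

variable {m p : ℕ}

/-- A matrix is in canonical form if its entries are `1` at positions `(r_1,c_1), …, (r_ρ,c_ρ)`
with `r_1 < ⋯ < r_ρ` and `c_1, …, c_ρ` distinct, and `0` elsewhere (`ρ = 0` is the zero matrix). -/
def IsCanonical (Q0 : Matrix (Fin p) (Fin m) ℝ) : Prop :=
  ∃ (ρ : ℕ) (r : Fin ρ → Fin p) (c : Fin ρ → Fin m), StrictMono r ∧ Function.Injective c ∧
    (∀ k, Q0 (r k) (c k) = 1) ∧ ∀ i j, (∀ k, (i, j) ≠ (r k, c k)) → Q0 i j = 0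

/-- `L Q U = Q0` is an `LCU` decomposition of `Q`: `U` is upper triangular with ones on the
diagonal, `L` is lower triangular and invertible, and `Q0` is in canonical form. -/
structure IsLCU (Q : Matrix (Fin p) (Fin m) ℝ) (L : Matrix (Fin p) (Fin p) ℝ)
    (Q0 : Matrix (Fin p) (Fin m) ℝ) (U : Matrix (Fin m) (Fin m) ℝ) : Prop where
  upper : ∀ i j, j < i → U i j = 0
  diag : ∀ i, U i i = 1
  lower : ∀ i j, i < j → L i j = 0
  isUnit : IsUnit L
  mul_eq : L * Q * U = Q0
  canonical : IsCanonical Q0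

/-- The condition `T ≥ max {max_k T_{m+r_k}(Λ) + T_{c_k}(Λ), T_{m+1}(Λ), T_m(Λ)}`, where the
`(r_k, c_k)` are the positions of the nonzero entries of the canonical form of `Q`. -/
def TimeCondition (hm : 1 ≤ m) (hp : 1 ≤ p) (lam : Idx m p → ℝ → ℝ)
    (Q : Matrix (Fin p) (Fin m) ℝ) (T : ℝ) : Prop :=
  (∀ L Q0 U, IsLCU Q L Q0 U → ∀ r c, Q0 r c ≠ 0 →
    travelTime lam (Sum.inr r) + travelTime lam (Sum.inl c) ≤ T) ∧
  travelTime lam (Sum.inr ⟨0, hp⟩) ≤ T ∧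
  travelTime lam (Sum.inl ⟨m - 1, Nat.sub_lt hm Nat.one_pos⟩) ≤ T

end LCU

/-! ### Solutions along the characteristics -/

section Solutions

variable {m p : ℕ}

/-- `s ↦ f s` is a continuous map from `I` to `L²(J)`. -/
def L2ContinuousOn (I J : Set ℝ) (f : ℝ → ℝ → ℝ) : Prop :=
  (∀ s ∈ I, MemLp (f s) 2 (volume.restrict J)) ∧
  ∀ s₀ ∈ I, Tendsto (fun s => eLpNorm (fun r => f s r - f s₀ r) 2 (volume.restrict J))
    (𝓝[I] s₀) (𝓝 0)

/-- The datum `b_i(t,x)` transported by the characteristic through `(t,x)`: the control or the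
boundary coupling `y_+(·,0) = Q y_-(·,0)` if it entered the domain after time `0`, and the initial
datum otherwise. -/
noncomputable def datum (lam : Idx m p → ℝ → ℝ) (Q : Matrix (Fin p) (Fin m) ℝ)
    (y0 : Idx m p → ℝ → ℝ) (u : Fin m → ℝ → ℝ) (y : Idx m p → ℝ → ℝ → ℝ) :
    Idx m p → ℝ → ℝ → ℝ
  | Sum.inl i, t, x =>
      if 0 < entryTime lam (Sum.inl i) t x then u i (entryTime lam (Sum.inl i) t x)
      else y0 (Sum.inl i) (characteristic lam (Sum.inl i) 0 t x)
  | Sum.inr i, t, x =>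
      if 0 < entryTime lam (Sum.inr i) t x then
        ∑ j : Fin m, Q i j * y (Sum.inl j) (entryTime lam (Sum.inr i) t x) 0
      else y0 (Sum.inr i) (characteristic lam (Sum.inr i) 0 t x)

/-- `y` (with `y i t x` the `i`-th component at time `t` and point `x`) is the solution along the
characteristics in `(0,S)` of
`∂_t y + Λ ∂_x y = 0`, `y_-(t,1) = u(t)`, `y_+(t,0) = Q y_-(t,0)`, `y(0,·) = y0`.
The class `C⁰([0,S]; L²(0,1)ⁿ) ∩ C⁰([0,1]; L²(0,S)ⁿ)` is expressed with a representative whose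
slices `y(t,·)` and `y(·,x)` are the values of these two continuous maps for every `t ∈ [0,S]` and
every `x ∈ [0,1]`; in particular `y i · 0` is the trace at `x = 0`. -/
structure IsSolution (lam : Idx m p → ℝ → ℝ) (Q : Matrix (Fin p) (Fin m) ℝ) (S : ℝ)
    (y0 : Idx m p → ℝ → ℝ) (u : Fin m → ℝ → ℝ) (y : Idx m p → ℝ → ℝ → ℝ) : Prop where
  memLp_initial : ∀ i, MemLp (y0 i) 2 (volume.restrict (Ioo 0 1))
  memLp_control : ∀ i, MemLp (u i) 2 (volume.restrict (Ioo 0 S))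
  measurable : ∀ i, AEStronglyMeasurable (fun z : ℝ × ℝ => y i z.1 z.2)
    (volume.restrict (Ioo 0 S ×ˢ Ioo 0 1))
  continuous_time : ∀ i, L2ContinuousOn (Icc 0 S) (Ioo 0 1) fun t x => y i t x
  continuous_space : ∀ i, L2ContinuousOn (Icc 0 1) (Ioo 0 S) fun x t => y i t x
  equation : ∀ i, ∀ᵐ z : ℝ × ℝ ∂(volume.restrict (Ioo 0 S ×ˢ Ioo 0 1)),
    y i z.1 z.2 = datum lam Q y0 u y i z.1 z.2

/-- `y` solves in `(0,S)` the system closed by the feedback law `u_i(t) = F_i(y(t,·))`. The law may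
evaluate the state at a point `x ∈ [0,1]`: by the choice of representative in `IsSolution`, the
function `y k · x` is the well-defined trace of `y` at `x`. -/
def IsClosedLoopSolution (lam : Idx m p → ℝ → ℝ) (Q : Matrix (Fin p) (Fin m) ℝ)
    (F : Fin m → (Idx m p → ℝ → ℝ) → ℝ) (S : ℝ) (y0 : Idx m p → ℝ → ℝ)
    (y : Idx m p → ℝ → ℝ → ℝ) : Prop :=
  IsSolution lam Q S y0 (fun i t => F i fun k => y k t) y

/-- The feedback law `F` stabilizes the system in finite time with settling time `T`: for every
initial datum in `L²(0,1)ⁿ` the closed-loop system has one and only one solution in `(0,S)` for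
every `S > 0`, and this solution vanishes at time `T` and at all later times. -/
def StabilizesInTime (lam : Idx m p → ℝ → ℝ) (Q : Matrix (Fin p) (Fin m) ℝ)
    (F : Fin m → (Idx m p → ℝ → ℝ) → ℝ) (T : ℝ) : Prop :=
  ∀ y0 : Idx m p → ℝ → ℝ, (∀ i, MemLp (y0 i) 2 (volume.restrict (Ioo 0 1))) →
    ∀ S : ℝ, 0 < S →
      (∃ y, IsClosedLoopSolution lam Q F S y0 y) ∧
      (∀ y z, IsClosedLoopSolution lam Q F S y0 y → IsClosedLoopSolution lam Q F S y0 z →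
        ∀ t ∈ Icc 0 S, ∀ i, y i t =ᵐ[volume.restrict (Ioo 0 1)] z i t) ∧
      ∀ y, IsClosedLoopSolution lam Q F S y0 y →
        ∀ t ∈ Icc T S, ∀ i, y i t =ᵐ[volume.restrict (Ioo 0 1)] 0

/-- The feedback law `u_i(t) = - ∑_{k > i} u^{ik} y_k(t, ζ_{ik}(1))`, where `U⁻¹ = (u^{ik})`. -/
noncomputable def feedback (lam : Idx m p → ℝ → ℝ) (U : Matrix (Fin m) (Fin m) ℝ)
    (i : Fin m) (w : Idx m p → ℝ → ℝ) : ℝ :=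
  -∑ k ∈ Finset.Ioi i, U⁻¹ i k * w (Sum.inl k) (zeta lam (Sum.inl i) (Sum.inl k) 1)

end Solutions

end Hyperbolic

namespace Hyperbolic

/-! ### Existence of the LCU decomposition by elimination. -/

section LCUExistence

variable {m p : ℕ}

/-! Component `i` is constant along its characteristics, hence a function of the label `τ = t -
∫_0^x dξ/λ_i`, the time at which the characteristic meets `x = 0`. In terms of labels the feedback
has no delay: `ζ_{ik}(1)` is the point where component `k` carries the label that component `i` has
at `x = 1` (`IsSpeeds.signedTime_zeta`). With `f(τ) = y_-(τ, 0)`, the law reads `(U⁻¹ f)_i(τ) = 0`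
for `τ > T_i` (`sum_mul_negProfile_eq_zero`). It involves only `k > i`, so `f` is found by
descending recursion and the solution is explicit (`closedLoop`).

For `τ > T_m` all of `U⁻¹ f` vanishes, hence so does `y_-`. The datum entering `y_+` is `Q f = L⁻¹
Q⁰ (U⁻¹ f)`. Row `i` of `L⁻¹` sees only the rows `r ≤ i` of `Q⁰`, and a nonzero entry `(r, c)` meets
only `(U⁻¹ f)_c`, which is zero after `T_c ≤ T - T_{m+r} ≤ T - T_{m+i}`. So what enters after `T -
T_{m+i}` is zero (`sum_coupling_negProfile_eq_zero`), and `T ≥ T_{m+1}` leaves time for the initial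
datum to exit.

Uniqueness follows the same triangular order (`IsClosedLoopSolution.ae_eq`): continuity in `x` with
values in `L²` carries almost everywhere equality to the traces read by the feedback and the
boundary coupling. The decomposition itself comes from elimination with leftmost pivots
(`IsReducedUpTo.exists_succ`). -/

theorem isCanonical_of_partialPermutation {A : Matrix (Fin p) (Fin m) ℝ}
    (h_one : ∀ i j, A i j ≠ 0 → A i j = 1)
    (h_row : ∀ i j j', A i j ≠ 0 → A i j' ≠ 0 → j = j')
    (h_col : ∀ i i' j, A i j ≠ 0 → A i' j ≠ 0 → i = i') : IsCanonical A := by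
  classical
  let R : Finset (Fin p) := Finset.univ.filter fun i => ∃ j, A i j ≠ 0
  have hR : ∀ k : Fin R.card, ∃ j, A (R.orderEmbOfFin rfl k) j ≠ 0 := fun k =>
    (Finset.mem_filter.1 (R.orderEmbOfFin_mem rfl k)).2
  choose c hc using hR
  refine ⟨R.card, R.orderEmbOfFin rfl, c, (R.orderEmbOfFin rfl).strictMono, ?_,
    fun k => h_one _ _ (hc k), ?_⟩
  · intro k l hkl
    exact (R.orderEmbOfFin rfl).injective (h_col _ _ _ (hc k) (hkl ▸ hc l))
  · intro i j hij
    by_contra hne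
    have hi : i ∈ Set.range (R.orderEmbOfFin rfl) := by
      rw [Finset.range_orderEmbOfFin]
      exact Finset.mem_coe.2 (Finset.mem_filter.2 ⟨Finset.mem_univ _, j, hne⟩)
    obtain ⟨k, rfl⟩ := hi
    exact hij k (by rw [h_row _ _ _ hne (hc k)])

/-- `U` is upper triangular with ones on the diagonal. -/
def IsUnitUpper (U : Matrix (Fin m) (Fin m) ℝ) : Prop :=
  U.BlockTriangular id ∧ ∀ i, U i i = 1

/-- `L` is lower triangular and invertible. -/
def IsUnitLower (L : Matrix (Fin p) (Fin p) ℝ) : Prop :=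
  L.BlockTriangular OrderDual.toDual ∧ IsUnit L

theorem IsUnitUpper.mul {U V : Matrix (Fin m) (Fin m) ℝ} (hU : IsUnitUpper U)
    (hV : IsUnitUpper V) : IsUnitUpper (U * V) := by
  refine ⟨hU.1.mul hV.1, fun i => ?_⟩
  rw [Matrix.mul_apply, Finset.sum_eq_single i]
  · rw [hU.2, hV.2, one_mul]
  · intro k _ hk
    rcases lt_or_gt_of_ne hk with h | h
    · rw [hU.1 (show id k < id i from h), zero_mul]
    · rw [hV.1 (show id i < id k from h), mul_zero]
  · simp

theorem IsUnitUpper.inv {U : Matrix (Fin m) (Fin m) ℝ} (hU : IsUnitUpper U) :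
    IsUnitUpper U⁻¹ ∧ U * U⁻¹ = 1 := by
  have hdet : U.det = 1 := by
    rw [Matrix.det_of_isUpperTriangular hU.1]
    simp [hU.2]
  have hunit : IsUnit U.det := by simp [hdet]
  have hinv : U * U⁻¹ = 1 := Matrix.mul_nonsing_inv U hunit
  let _ := Matrix.invertibleOfIsUnitDet U hunit
  have htri : U⁻¹.BlockTriangular id := Matrix.blockTriangular_inv_of_blockTriangular hU.1
  refine ⟨⟨htri, fun i => ?_⟩, hinv⟩
  have h := congrFun (congrFun hinv i) i
  rw [Matrix.mul_apply, Finset.sum_eq_single i, hU.2, one_mul, Matrix.one_apply_eq] at h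
  · exact h
  · intro k _ hk
    rcases lt_or_gt_of_ne hk with h | h
    · rw [hU.1 (show id k < id i from h), zero_mul]
    · rw [htri (show id i < id k from h), mul_zero]
  · simp

theorem IsUnitLower.inv {L : Matrix (Fin p) (Fin p) ℝ} (hL : IsUnitLower L) :
    L⁻¹.BlockTriangular OrderDual.toDual ∧ L⁻¹ * L = 1 := by
  have hunit : IsUnit L.det := (Matrix.isUnit_iff_isUnit_det L).1 hL.2
  let _ := Matrix.invertibleOfIsUnitDet L hunit
  exact ⟨Matrix.blockTriangular_inv_of_blockTriangular hL.1, Matrix.nonsing_inv_mul L hunit⟩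

/-- The first `k` rows of `A` have the shape required of a canonical form, and the pivots clear
their columns. -/
def IsReducedUpTo (k : ℕ) (A : Matrix (Fin p) (Fin m) ℝ) : Prop :=
  ∀ i : Fin p, (i : ℕ) < k → ∀ j, A i j ≠ 0 →
    A i j = 1 ∧ (∀ j', j' ≠ j → A i j' = 0) ∧ ∀ i', i' ≠ i → A i' j = 0

theorem IsReducedUpTo.isCanonical {A : Matrix (Fin p) (Fin m) ℝ} (h : IsReducedUpTo p A) :
    IsCanonical A := by
  refine isCanonical_of_partialPermutation (fun i j hij => (h i i.2 j hij).1) ?_ ?_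
  · intro i j j' hj hj'
    by_contra hne
    exact hj' ((h i i.2 j hj).2.1 j' (Ne.symm hne))
  · intro i i' j hi hi'
    by_contra hne
    exact hi' ((h i i.2 j hi).2.2 i' (Ne.symm hne))

/-- Elimination of the row `k`. -/
theorem IsReducedUpTo.exists_succ {A : Matrix (Fin p) (Fin m) ℝ} {k : Fin p}
    (h : IsReducedUpTo k A) : ∃ (E : Matrix (Fin p) (Fin p) ℝ) (V : Matrix (Fin m) (Fin m) ℝ), IsUnitLower E ∧ IsUnitUpper V ∧
      IsReducedUpTo (k + 1) (E * (A * V)) := by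
  by_cases hk : ∀ j, A k j = 0
  · refine ⟨1, 1, ⟨Matrix.blockTriangular_one, isUnit_one⟩,
      ⟨Matrix.blockTriangular_one, fun i => Matrix.one_apply_eq i⟩, ?_⟩
    rw [Matrix.mul_one, Matrix.one_mul]
    intro i hi j hij
    rcases Nat.lt_succ_iff_lt_or_eq.1 hi with hlt | heq
    · exact h i hlt j hij
    · exact absurd (hk j) (Fin.ext heq ▸ hij)
  push Not at hk
  -- The pivot is the leftmost nonzero entry of row `k`, so clearing this row only changes columns
  -- to the right of `c`; this keeps `V` upper triangular.
  obtain ⟨c, hc, hmin⟩ := WellFounded.has_min (wellFounded_lt (α := Fin m))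
    {j | A k j ≠ 0} hk
  have hc : A k c ≠ 0 := hc
  have hleft : ∀ j, j < c → A k j = 0 := fun j hj => by
    by_contra hne
    exact hmin j hne hj
  -- A nonzero entry above the pivot would be an earlier pivot and would have cleared position `(k,
  -- c)`. This keeps `E` lower triangular.
  have habove : ∀ i : Fin p, i < k → A i c = 0 := fun i hi => by
    by_contra hne
    exact hc ((h i hi c hne).2.2 k hi.ne')
  -- `V` subtracts multiples of column `c` to clear row `k`; `E` then scales the pivot to `1` and
  -- subtracts multiples of row `k` to clear column `c`.
  let v : Fin m → ℝ := fun j => if j = c then 0 else -(A k j / A k c)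
  let w : Fin p → ℝ := fun i => if i = k then 1 / A k c - 1 else -(A i c / A k c)
  let V : Matrix (Fin m) (Fin m) ℝ := 1 + Matrix.vecMulVec (Pi.single c 1) v
  let E : Matrix (Fin p) (Fin p) ℝ := 1 + Matrix.vecMulVec w (Pi.single k 1)
  have hV : ∀ i j, V i j = (1 : Matrix (Fin m) (Fin m) ℝ) i j + if i = c then v j else 0 := by
    intro i j
    simp [V, Matrix.vecMulVec_apply, Pi.single_apply]
  have hE : ∀ i j, E i j = (1 : Matrix (Fin p) (Fin p) ℝ) i j + if j = k then w i else 0 := by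
    intro i j
    simp [E, Matrix.vecMulVec_apply, Pi.single_apply]
  have hAV : ∀ i j, (A * V) i j = A i j + A i c * v j := by
    intro i j
    simp [Matrix.mul_apply, hV, mul_add, Finset.sum_add_distrib, Matrix.one_apply]
  have hEAV : ∀ i j, (E * (A * V)) i j = A i j + A i c * v j + w i * (A k j + A k c * v j) := by
    intro i j
    rw [Matrix.mul_apply]
    simp [hE, add_mul, Finset.sum_add_distrib, Matrix.one_apply, hAV]
  have hpivot : ∀ i, (E * (A * V)) i c = if i = k then 1 else 0 := by
    intro i
    rw [hEAV]
    by_cases hi : i = k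
    · subst hi
      simp only [v, w, if_true]
      field_simp
      ring
    · simp only [v, w, if_true, if_neg hi]
      field_simp
      ring
  have hother : ∀ i j, j ≠ c → (E * (A * V)) i j = A i j - A i c * (A k j / A k c) := by
    intro i j hj
    rw [hEAV]
    simp only [v, if_neg hj]
    field_simp
    ring
  have hlower : E.BlockTriangular OrderDual.toDual := by
    intro i j hij
    have hij : i < j := hij
    rw [hE, Matrix.one_apply_ne hij.ne]
    by_cases hj : j = k
    · subst hj
      simp [w, hij.ne, habove i hij]
    · simp [hj]
  refine ⟨E, V, ⟨hlower, ?_⟩, ⟨?_, ?_⟩, ?_⟩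
  · rw [Matrix.isUnit_iff_isUnit_det, Matrix.det_of_isLowerTriangular _ hlower, isUnit_iff_ne_zero,
      Finset.prod_ne_zero_iff]
    intro i _
    rw [hE, Matrix.one_apply_eq]
    by_cases hi : i = k
    · simp [hi, w, hc]
    · simp [hi]
  · intro i j hij
    have hij : j < i := hij
    rw [hV, Matrix.one_apply_ne hij.ne']
    by_cases hi : i = c
    · subst hi
      simp [v, hij.ne, hleft j hij]
    · simp [hi]
  · intro i
    rw [hV, Matrix.one_apply_eq]
    by_cases hi : i = c
    · simp [hi, v]
    · simp [hi]
  · intro i hi j hij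
    rcases Nat.lt_succ_iff_lt_or_eq.1 hi with hlt | heq
    -- Earlier rows vanish in column `c`, so neither operation alters them.
    · have hik : i ≠ k := fun h => by simp [h] at hlt
      have hic : A i c = 0 := habove i hlt
      have hjc : j ≠ c := by
        rintro rfl
        rw [hpivot, if_neg hik] at hij
        exact hij rfl
      have hrow : ∀ j', (E * (A * V)) i j' = A i j' := by
        intro j'
        by_cases hj' : j' = c
        · rw [hj', hpivot, if_neg hik, hic]
        · rw [hother i j' hj', hic, zero_mul, sub_zero]
      rw [hrow] at hij
      obtain ⟨h1, h2, h3⟩ := h i hlt j hij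
      refine ⟨(hrow j).trans h1, fun j' hj' => (hrow j').trans (h2 j' hj'), fun i' hi' => ?_⟩
      rw [hother i' j hjc, h3 i' hi', h3 k hik.symm]
      simp
    · have hik : i = k := Fin.ext heq
      subst hik
      have hrow : ∀ j', j' ≠ c → (E * (A * V)) i j' = 0 := by
        intro j' hj'
        rw [hother i j' hj']
        field_simp
        ring
      have hjc : j = c := by
        by_contra hne
        exact hij (hrow j hne)
      subst hjc
      refine ⟨by rw [hpivot, if_pos rfl], hrow, fun i' hi' => ?_⟩
      rw [hpivot, if_neg hi']

/-- The factors `E` accumulate on the left and the factors `V` on the right; both triangular classes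
are stable under products. -/
theorem exists_isLCU (Q : Matrix (Fin p) (Fin m) ℝ) : ∃ L Q0 U, IsLCU Q L Q0 U := by
  have key : ∀ k : ℕ, k ≤ p → ∃ (L : Matrix (Fin p) (Fin p) ℝ) (U : Matrix (Fin m) (Fin m) ℝ), IsUnitLower L ∧ IsUnitUpper U ∧
      IsReducedUpTo k (L * Q * U) := by
    intro k
    induction k with
    | zero =>
      exact fun _ => ⟨1, 1, ⟨Matrix.blockTriangular_one, isUnit_one⟩,
        ⟨Matrix.blockTriangular_one, fun i => Matrix.one_apply_eq i⟩,
        fun i hi => absurd hi (Nat.not_lt_zero _)⟩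
    | succ k ih =>
      intro hk
      obtain ⟨L, U, hL, hU, hred⟩ := ih (Nat.le_of_succ_le hk)
      obtain ⟨E, V, hE, hV, hred'⟩ := IsReducedUpTo.exists_succ (k := ⟨k, hk⟩) hred
      refine ⟨E * L, U * V, ⟨hE.1.mul hL.1, hE.2.mul hL.2⟩, hU.mul hV, ?_⟩
      have : E * L * Q * (U * V) = E * (L * Q * U * V) := by
        simp only [Matrix.mul_assoc]
      rw [this]
      exact hred'
  obtain ⟨L, U, hL, hU, hred⟩ := key p le_rfl
  exact ⟨L, _, U, ⟨fun i j hij => hU.1 hij, hU.2, fun i j hij => hL.1 hij, hL.2, rfl,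
    hred.isCanonical⟩⟩

theorem IsLCU.isUnitUpper {Q : Matrix (Fin p) (Fin m) ℝ} {L Q0 U} (h : IsLCU Q L Q0 U) :
    IsUnitUpper U := ⟨fun i j hij => h.upper i j hij, h.diag⟩

theorem IsLCU.isUnitLower {Q : Matrix (Fin p) (Fin m) ℝ} {L Q0 U} (h : IsLCU Q L Q0 U) :
    IsUnitLower L := ⟨fun i j hij => h.lower i j hij, h.isUnit⟩

end LCUExistence

end Hyperbolic

namespace Hyperbolic

/-! ### Composition, translation and continuity in `L²`. -/

section SquareIntegrable

open scoped ENNReal NNReal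

/-- On the line, Lebesgue measure is the one-dimensional Hausdorff measure, for which preimages
under antilipschitz maps grow at most by the factor `K`. -/
theorem map_volume_le_of_antilipschitz {θ : ℝ → ℝ} {K : ℝ≥0} (hK : AntilipschitzWith K θ)
    (hθ : Measurable θ) : (volume : Measure ℝ).map θ ≤ (K : ℝ≥0∞) • volume := by
  refine Measure.le_iff.2 fun s hs => ?_
  rw [Measure.map_apply hθ hs]
  have := hK.hausdorffMeasure_preimage_le (d := 1) zero_le_one s
  rw [hausdorffMeasure_real] at this
  simpa using this

theorem eLpNorm_comp_le_of_antilipschitz {θ : ℝ → ℝ} {K : ℝ≥0} (hK : AntilipschitzWith K θ)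
    (hθ : Measurable θ) {F : ℝ → ℝ} (hF : AEStronglyMeasurable F volume) (J : Set ℝ) :
    eLpNorm (fun r => F (θ r)) 2 (volume.restrict J) ≤
      (K : ℝ≥0∞) ^ (1 / (2 : ℝ≥0∞)).toReal * eLpNorm F 2 volume := by
  have hle := map_volume_le_of_antilipschitz hK hθ
  calc eLpNorm (fun r => F (θ r)) 2 (volume.restrict J)
      ≤ eLpNorm (F ∘ θ) 2 volume := eLpNorm_mono_measure _ Measure.restrict_le_self
    _ = eLpNorm F 2 (volume.map θ) :=
        (eLpNorm_map_measure (hF.mono_ac (Measure.absolutelyContinuous_of_le_smul hle))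
          hθ.aemeasurable).symm
    _ ≤ _ := eLpNorm_le_of_measure_le_smul hle

theorem memLp_comp_of_antilipschitz {θ : ℝ → ℝ} {K : ℝ≥0} (hK : AntilipschitzWith K θ)
    (hθ : Measurable θ) {F : ℝ → ℝ} (hF : MemLp F 2 volume) :
    MemLp (fun r => F (θ r)) 2 volume :=
  (hF.of_measure_le_smul ENNReal.coe_ne_top (map_volume_le_of_antilipschitz hK hθ)).comp_of_map
    hθ.aemeasurable

/-- Translations act continuously on `L²(ℝ)`. -/
theorem tendsto_eLpNorm_translate {F : ℝ → ℝ} (hF : MemLp F 2 volume) :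
    Tendsto (fun a : ℝ => eLpNorm (fun r => F (a + r) - F r) 2 volume) (𝓝 0) (𝓝 0) := by
  have : Fact ((2 : ℝ≥0∞) ≠ ∞) := ⟨by simp⟩
  have hc : Continuous fun a : ℝ => DomAddAct.mk a +ᵥ hF.toLp F :=
    (DomAddAct.continuous_mk).vadd continuous_const
  have h := (hc.tendsto 0).edist (tendsto_const_nhds (x := hF.toLp F))
  have h0 : DomAddAct.mk (0 : ℝ) +ᵥ hF.toLp F = hF.toLp F := by
    change (0 : ℝᵈᵃᵃ) +ᵥ hF.toLp F = _
    exact zero_vadd _ _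
  rw [h0, edist_self] at h
  refine h.congr fun a => ?_
  rw [DomAddAct.mk_vadd_toLp, Lp.edist_toLp_toLp]
  rfl

/-- Transport of an `L²` profile along a family of curves depending continuously on a
parameter. -/
theorem l2ContinuousOn_profile {F : ℝ → ℝ} (hF : MemLp F 2 volume) {a b : ℝ → ℝ}
    (ha : Continuous a) {K : ℝ≥0} (hK : AntilipschitzWith K b) (hb : Measurable b) (I J : Set ℝ) :
    L2ContinuousOn I J fun s r => F (a s + b r) := by
  have hK' : ∀ c : ℝ, AntilipschitzWith K fun r => c + b r := fun c x y => by
    simpa [edist_dist, Real.dist_eq] using hK x y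
  refine ⟨fun s _ => (memLp_comp_of_antilipschitz (hK' (a s)) (hb.const_add _) hF).restrict J,
    fun s₀ _ => ?_⟩
  -- The increment in `s` is the translation increment of `F` by `a s - a s₀`, evaluated at `a s₀ +
  -- b r`; the antilipschitz bound on this inner map controls its norm.
  have ht : Tendsto (fun s => a s - a s₀) (𝓝[I] s₀) (𝓝 0) := by
    have := (ha.tendsto s₀).sub_const (a s₀)
    rw [sub_self] at this
    exact this.mono_left nhdsWithin_le_nhds
  have h := ENNReal.Tendsto.const_mul ((tendsto_eLpNorm_translate hF).comp ht)
    (Or.inr (ENNReal.rpow_ne_top_of_nonneg ENNReal.toReal_nonneg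
      (ENNReal.coe_ne_top (r := K)) : (K : ℝ≥0∞) ^ (1 / (2 : ℝ≥0∞)).toReal ≠ ∞))
  rw [mul_zero] at h
  refine tendsto_of_tendsto_of_tendsto_of_le_of_le tendsto_const_nhds h (fun _ => zero_le)
    fun s => ?_
  have hm : MemLp (fun r => F (a s - a s₀ + r) - F r) 2 volume :=
    (memLp_comp_of_antilipschitz (K := 1)
      (AntilipschitzWith.of_le_mul_dist fun x y => by simp [Real.dist_eq])
      (measurable_id.const_add _) hF).sub hF
  refine le_trans (le_of_eq ?_)
    (eLpNorm_comp_le_of_antilipschitz (hK' (a s₀)) (hb.const_add _) hm.1 J)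
  refine congrArg (fun g => eLpNorm g 2 (volume.restrict J)) (funext fun r => ?_)
  rw [show a s - a s₀ + (a s₀ + b r) = a s + b r by ring]

/-- Two continuous maps to `L²` which agree almost everywhere agree everywhere. -/
theorem L2ContinuousOn.ae_eq {f g : ℝ → ℝ → ℝ} {a b : ℝ} (hab : a < b) {J : Set ℝ}
    (hf : L2ContinuousOn (Icc a b) J f) (hg : L2ContinuousOn (Icc a b) J g)
    (hfg : ∀ᵐ s ∂(volume.restrict (Ioo a b)), f s =ᵐ[volume.restrict J] g s) :
    ∀ s ∈ Icc a b, f s =ᵐ[volume.restrict J] g s := by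
  intro s₀ hs₀
  have hdense : s₀ ∈ closure {s | s ∈ Ioo a b ∧ f s =ᵐ[volume.restrict J] g s} := by
    have hcl : s₀ ∈ closure (Ioo a b) := by rwa [closure_Ioo hab.ne]
    refine closure_minimal ?_ isClosed_closure hcl
    rw [ae_restrict_iff' measurableSet_Ioo] at hfg
    intro s hs
    have := (Measure.dense_of_ae hfg).open_subset_closure_inter isOpen_Ioo hs
    refine closure_mono ?_ this
    exact fun r hr => ⟨hr.1, hr.2 hr.1⟩
  have : (𝓝[{s | s ∈ Ioo a b ∧ f s =ᵐ[volume.restrict J] g s}] s₀).NeBot :=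
    mem_closure_iff_nhdsWithin_neBot.1 hdense
  have hsub : {s | s ∈ Ioo a b ∧ f s =ᵐ[volume.restrict J] g s} ⊆ Icc a b :=
    fun s hs => Ioo_subset_Icc_self hs.1
  -- Approach `s₀` through the dense set where the slices agree: there `f s₀ - g s₀` is the
  -- difference of two increments, both small in `L²`.
  have hlim := ((hf.2 s₀ hs₀).mono_left (nhdsWithin_mono s₀ hsub)).add
    ((hg.2 s₀ hs₀).mono_left (nhdsWithin_mono s₀ hsub))
  rw [add_zero] at hlim
  have hmeas := ((hf.1 s₀ hs₀).sub (hg.1 s₀ hs₀)).1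
  have hzero : eLpNorm (f s₀ - g s₀) 2 (volume.restrict J) ≤ 0 := by
    refine ge_of_tendsto hlim ?_
    filter_upwards [self_mem_nhdsWithin] with s hs
    have hsI := hsub hs
    have hsplit : f s₀ - g s₀ =ᵐ[volume.restrict J]
        (fun r => -(f s r - f s₀ r)) + fun r => g s r - g s₀ r := by
      filter_upwards [hs.2] with r hr
      simp only [Pi.sub_apply, Pi.add_apply, hr]
      ring
    rw [eLpNorm_congr_ae hsplit]
    refine (eLpNorm_add_le ((hf.1 s hsI).sub (hf.1 s₀ hs₀)).1.neg
      ((hg.1 s hsI).sub (hg.1 s₀ hs₀)).1 (by norm_num)).trans (le_of_eq ?_)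
    congr 1
    exact eLpNorm_neg _ _ _
  have := (eLpNorm_eq_zero_iff hmeas (by norm_num)).1 (le_antisymm hzero zero_le)
  filter_upwards [this] with r hr
  exact sub_eq_zero.1 hr

end SquareIntegrable

/-! ### Travel times and labels of characteristics. -/

section Travel

variable {m p : ℕ} {lam : Idx m p → ℝ → ℝ}

/-- The signed time `∫_0^x dξ / λ_i(ξ)` needed to go from `0` to `x` at speed `λ_i`. -/
noncomputable def signedTime (lam : Idx m p → ℝ → ℝ) (i : Idx m p) (x : ℝ) : ℝ :=
  ∫ ξ in (0 : ℝ)..x, 1 / speedExt lam i ξ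

/-- The position at time `s` of the particle which starts from `0` with speed `λ_i`. -/
noncomputable def position (lam : Idx m p → ℝ → ℝ) (i : Idx m p) (s : ℝ) : ℝ :=
  characteristic lam i s 0 0

theorem IsSpeeds.signedTime_injective (h : IsSpeeds lam) (i : Idx m p) :
    Function.Injective (signedTime lam i) := h.primitive_injective i 0

theorem signedTime_zero (i : Idx m p) : signedTime lam i 0 = 0 :=
  intervalIntegral.integral_same

theorem IsSpeeds.hasDerivAt_signedTime (h : IsSpeeds lam) (i : Idx m p) (x : ℝ) :
    HasDerivAt (signedTime lam i) (1 / speedExt lam i x) x := h.hasDerivAt_primitive i 0 x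

theorem IsSpeeds.integral_eq_signedTime_sub (h : IsSpeeds lam) (i : Idx m p) (x y : ℝ) :
    ∫ ξ in x..y, 1 / speedExt lam i ξ = signedTime lam i y - signedTime lam i x := by
  have hc : Continuous fun ξ => 1 / speedExt lam i ξ :=
    continuous_const.div (h.continuous_speedExt i) (h.speedExt_ne_zero i)
  exact (intervalIntegral.integral_interval_sub_left (hc.intervalIntegrable _ _)
    (hc.intervalIntegrable _ _)).symm

theorem IsSpeeds.signedTime_position (h : IsSpeeds lam) (i : Idx m p) (s : ℝ) :
    signedTime lam i (position lam i s) = s :=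
  ((isCharacteristic_characteristic h i 0 0).integral_eq h s).trans (sub_zero s)

theorem IsSpeeds.position_signedTime (h : IsSpeeds lam) (i : Idx m p) (x : ℝ) :
    position lam i (signedTime lam i x) = x :=
  h.signedTime_injective i (h.signedTime_position i _)

theorem IsSpeeds.characteristic_zero (h : IsSpeeds lam) (i : Idx m p) (t x : ℝ) :
    characteristic lam i 0 t x = position lam i (-(t - signedTime lam i x)) := by
  apply h.signedTime_injective i
  have := (isCharacteristic_characteristic h i t x).integral_eq h 0
  rw [h.integral_eq_signedTime_sub] at this
  rw [h.signedTime_position]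
  linarith

theorem IsSpeeds.entryTime_inl (h : IsSpeeds lam) (i : Fin m) (t x : ℝ) :
    entryTime lam (Sum.inl i) t x =
      t - signedTime lam (Sum.inl i) x + signedTime lam (Sum.inl i) 1 := by
  have := h.integral_eq_signedTime_sub (Sum.inl i) x 1
  simp only [entryTime, one_div, inv_neg, intervalIntegral.integral_neg] at this ⊢
  linarith

theorem entryTime_inr (i : Fin p) (t x : ℝ) :
    entryTime lam (Sum.inr i) t x = t - signedTime lam (Sum.inr i) x := rfl

theorem speedExt_of_mem {i : Idx m p} {x : ℝ} (hx : x ∈ Icc (0 : ℝ) 1) :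
    speedExt lam i x = lam i x := by
  simp [speedExt, projIcc_of_mem zero_le_one hx]

theorem signedTime_one (i : Idx m p) :
    signedTime lam i 1 = ∫ ξ in (0 : ℝ)..1, 1 / lam i ξ := by
  refine intervalIntegral.integral_congr fun ξ hξ => ?_
  rw [uIcc_of_le zero_le_one] at hξ
  simp only [speedExt_of_mem hξ]

theorem travelTime_inl (i : Fin m) :
    travelTime lam (Sum.inl i) = -signedTime lam (Sum.inl i) 1 := by
  simp [travelTime, signedTime_one, inv_neg]

theorem travelTime_inr (i : Fin p) :
    travelTime lam (Sum.inr i) = signedTime lam (Sum.inr i) 1 := by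
  simp [travelTime, signedTime_one]

theorem IsSpeeds.exists_lipschitz_signedTime (h : IsSpeeds lam) (i : Idx m p) :
    ∃ K, LipschitzWith K (signedTime lam i) := by
  obtain ⟨a, b, ha, hab⟩ := h.exists_bounds i
  refine ⟨(1 / a).toNNReal, lipschitzWith_of_nnnorm_deriv_le
    (fun x => (h.hasDerivAt_signedTime i x).differentiableAt) fun x => ?_⟩
  rw [(h.hasDerivAt_signedTime i x).deriv]
  apply NNReal.le_toNNReal_of_coe_le
  simp only [coe_nnnorm, Real.norm_eq_abs, abs_div, abs_one]
  exact one_div_le_one_div_of_le ha (hab x).1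

theorem IsSpeeds.exists_lipschitz_position (h : IsSpeeds lam) (i : Idx m p) :
    ∃ K, LipschitzWith K (position lam i) := by
  obtain ⟨a, b, ha, hab⟩ := h.exists_bounds i
  have hd : ∀ s, HasDerivAt (position lam i) (speedExt lam i (position lam i s)) s :=
    (isCharacteristic_characteristic h i 0 0).2
  refine ⟨b.toNNReal, lipschitzWith_of_nnnorm_deriv_le
    (fun s => (hd s).differentiableAt) fun s => ?_⟩
  rw [(hd s).deriv]
  exact NNReal.le_toNNReal_of_coe_le (hab _).2

/-- The inverse `position` is Lipschitz because the speed is bounded. This allows an `L²` profile to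
be read as a function of `x`. -/
theorem IsSpeeds.exists_antilipschitz_signedTime (h : IsSpeeds lam) (i : Idx m p) :
    ∃ K, AntilipschitzWith K (signedTime lam i) :=
  (h.exists_lipschitz_position i).imp fun _ hK => hK.to_rightInverse (h.position_signedTime i)

theorem IsSpeeds.exists_antilipschitz_position (h : IsSpeeds lam) (i : Idx m p) :
    ∃ K, AntilipschitzWith K (position lam i) :=
  (h.exists_lipschitz_signedTime i).imp fun _ hK => hK.to_rightInverse (h.signedTime_position i)

theorem IsSpeeds.continuous_signedTime (h : IsSpeeds lam) (i : Idx m p) :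
    Continuous (signedTime lam i) :=
  (h.exists_lipschitz_signedTime i).elim fun _ hK => hK.continuous

theorem IsSpeeds.continuous_position (h : IsSpeeds lam) (i : Idx m p) :
    Continuous (position lam i) :=
  (h.exists_lipschitz_position i).elim fun _ hK => hK.continuous

theorem IsSpeeds.signedTime_strictAnti (h : IsSpeeds lam) (i : Fin m) :
    StrictAnti (signedTime lam (Sum.inl i)) := strictAnti_of_deriv_neg fun x => by
  rw [(h.hasDerivAt_signedTime _ x).deriv]
  exact one_div_neg.2 (h.speedExt_neg i x)

theorem IsSpeeds.signedTime_strictMono (h : IsSpeeds lam) (i : Fin p) :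
    StrictMono (signedTime lam (Sum.inr i)) := strictMono_of_deriv_pos fun x => by
  rw [(h.hasDerivAt_signedTime _ x).deriv]
  exact one_div_pos.2 (h.speedExt_pos i x)

theorem IsSpeeds.signedTime_one_le (h : IsSpeeds lam) {i j : Idx m p}
    (hij : ∀ x, 1 / speedExt lam i x ≤ 1 / speedExt lam j x) :
    signedTime lam i 1 ≤ signedTime lam j 1 := by
  have hc : ∀ i, Continuous fun ξ => 1 / speedExt lam i ξ := fun i =>
    continuous_const.div (h.continuous_speedExt i) (h.speedExt_ne_zero i)
  exact intervalIntegral.integral_mono zero_le_one ((hc i).intervalIntegrable _ _)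
    ((hc j).intervalIntegrable _ _) hij

/-- Among negative speeds, a larger index means a smaller modulus, so `T_m` is the longest time. -/
theorem IsSpeeds.travelTime_inl_mono (h : IsSpeeds lam) :
    Monotone fun i : Fin m => travelTime lam (Sum.inl i) := by
  intro i j hij
  simp only [travelTime_inl, neg_le_neg_iff]
  exact h.signedTime_one_le fun x => one_div_le_one_div_of_neg_of_le (h.speedExt_neg j x)
    ((h.strictMono_neg _ (projIcc (0 : ℝ) 1 zero_le_one x).2).monotone hij)

theorem IsSpeeds.travelTime_inr_anti (h : IsSpeeds lam) :
    Antitone fun i : Fin p => travelTime lam (Sum.inr i) := by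
  intro i j hij
  simp only [travelTime_inr]
  exact h.signedTime_one_le fun x => one_div_le_one_div_of_le (h.speedExt_pos i x)
    ((h.strictMono_pos _ (projIcc (0 : ℝ) 1 zero_le_one x).2).monotone hij)

theorem IsSpeeds.travelTime_inl_pos (h : IsSpeeds lam) (i : Fin m) :
    0 < travelTime lam (Sum.inl i) := by
  rw [travelTime_inl, neg_pos, ← signedTime_zero (lam := lam) (Sum.inl i)]
  exact h.signedTime_strictAnti i zero_lt_one

/-- A particle of speed `λ_j` reaches `ζ_{ij}(s)` when a particle of speed `λ_i` reaches `s`. -/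
theorem IsSpeeds.signedTime_zeta (h : IsSpeeds lam) (i j : Idx m p) (s : ℝ) :
    signedTime lam j (zeta lam i j s) = signedTime lam i s := by
  have hz : IsZeta lam i j fun s => position lam j (signedTime lam i s) := by
    refine ⟨?_, fun s => ?_⟩
    · simp only [signedTime_zero]
      exact (isCharacteristic_characteristic h j 0 0).1
    · have := ((isCharacteristic_characteristic h j 0 0).2 (signedTime lam i s)).comp s
        (h.hasDerivAt_signedTime i s)
      rwa [mul_one_div] at this
  rw [(isZeta_zeta h i j).unique h hz, h.signedTime_position]

/-- The signed time of component `k` at this point is `-T_i`, which lies in `[-T_k, 0]`. Hence the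
feedback reads a trace inside the domain. -/
theorem IsSpeeds.zeta_one_mem (h : IsSpeeds lam) {i k : Fin m} (hik : i ≤ k) :
    zeta lam (Sum.inl i) (Sum.inl k) 1 ∈ Icc (0 : ℝ) 1 := by
  have hz := h.signedTime_zeta (Sum.inl i) (Sum.inl k) 1
  have hik := h.travelTime_inl_mono hik
  have hi := h.travelTime_inl_pos i
  simp only [travelTime_inl] at hik hi
  constructor
  · rw [← (h.signedTime_strictAnti k).le_iff_ge, hz, signedTime_zero]
    linarith
  · rw [← (h.signedTime_strictAnti k).le_iff_ge, hz]
    linarith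

/-- The label `t - ∫_0^x dξ / λ_i(ξ)` of the characteristic through `(t, x)`, up to a constant. -/
theorem IsSpeeds.quasiMeasurePreserving_label (h : IsSpeeds lam) (i : Idx m p) (c : ℝ) :
    Measure.QuasiMeasurePreserving (fun z : ℝ × ℝ => z.1 - signedTime lam i z.2 + c) volume
      volume := by
  have hc := h.continuous_signedTime i
  -- For fixed `x` the map is a translation in `t`.
  refine QuasiMeasurePreserving.prod_of_left (Continuous.measurable (by fun_prop))
    (Eventually.of_forall fun x => ?_)
  have := (measurePreserving_add_right volume (-signedTime lam i x + c)).quasiMeasurePreserving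
  refine (funext fun t => ?_ : (fun t => t + (-signedTime lam i x + c)) =
    fun t : ℝ => t - signedTime lam i x + c) ▸ this
  ring

end Travel

end Hyperbolic

namespace Hyperbolic

variable {m p : ℕ} {lam : Idx m p → ℝ → ℝ}

/-! ### The explicit closed-loop solution and its extinction. -/

section ClosedLoop

/-- The initial datum, as a function of the label `t - ∫_0^x dξ / λ_i(ξ)` of characteristics. -/
noncomputable def initialProfile (lam : Idx m p → ℝ → ℝ) (y0 : Idx m p → ℝ → ℝ) (i : Idx m p)
    (τ : ℝ) : ℝ :=
  (Icc (0 : ℝ) 1).indicator (y0 i) (position lam i (-τ))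

/-- The trace at `x = 0` of the components of negative speed of the closed-loop solution, where
the feedback law has coefficients `N`. -/
noncomputable def negProfile (lam : Idx m p → ℝ → ℝ) (N : Matrix (Fin m) (Fin m) ℝ)
    (y0 : Idx m p → ℝ → ℝ) (i : Fin m) : ℝ → ℝ := fun τ =>
  -- `T_i` is the label of the corner `(t, x) = (0, 1)`: smaller labels carry the initial datum
  -- (extended by zero), larger ones the control.
  if τ ≤ travelTime lam (Sum.inl i) then initialProfile lam y0 (Sum.inl i) τ
  else -∑ k ∈ (Finset.Ioi i).attach, N i k * negProfile lam N y0 k τ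
termination_by m - i
decreasing_by
  have := Finset.mem_Ioi.1 k.2
  omega

theorem negProfile_eq (N : Matrix (Fin m) (Fin m) ℝ) (y0 : Idx m p → ℝ → ℝ) (i : Fin m)
    (τ : ℝ) : negProfile lam N y0 i τ =
      if τ ≤ travelTime lam (Sum.inl i) then initialProfile lam y0 (Sum.inl i) τ
      else -∑ k ∈ Finset.Ioi i, N i k * negProfile lam N y0 k τ := by
  rw [negProfile, ← Finset.sum_attach (Finset.Ioi i)]

/-- The components of the closed-loop solution, as functions of the label of characteristics. -/
noncomputable def profile (lam : Idx m p → ℝ → ℝ) (Q : Matrix (Fin p) (Fin m) ℝ)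
    (N : Matrix (Fin m) (Fin m) ℝ) (y0 : Idx m p → ℝ → ℝ) : Idx m p → ℝ → ℝ
  | Sum.inl i => negProfile lam N y0 i
  | Sum.inr i => fun τ =>
      if 0 < τ then ∑ j, Q i j * negProfile lam N y0 j τ
      else initialProfile lam y0 (Sum.inr i) τ

/-- The explicit solution of the closed-loop system. -/
noncomputable def closedLoop (lam : Idx m p → ℝ → ℝ) (Q : Matrix (Fin p) (Fin m) ℝ)
    (N : Matrix (Fin m) (Fin m) ℝ) (y0 : Idx m p → ℝ → ℝ) (i : Idx m p) (t x : ℝ) : ℝ :=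
  profile lam Q N y0 i (t - signedTime lam i x)

variable {Q : Matrix (Fin p) (Fin m) ℝ} {N U : Matrix (Fin m) (Fin m) ℝ} {y0 : Idx m p → ℝ → ℝ}

theorem memLp_initialProfile (h : IsSpeeds lam) {i : Idx m p}
    (hy0 : MemLp (y0 i) 2 (volume.restrict (Ioo 0 1))) :
    MemLp (initialProfile lam y0 i) 2 volume := by
  obtain ⟨K, hK⟩ := h.exists_antilipschitz_position i
  have hy : MemLp ((Icc (0 : ℝ) 1).indicator (y0 i)) 2 volume := by
    rw [memLp_indicator_iff_restrict measurableSet_Icc]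
    rwa [← restrict_Ioo_eq_restrict_Icc]
  refine memLp_comp_of_antilipschitz (K := K) (θ := fun τ => position lam i (-τ)) ?_ ?_ hy
  · intro x y
    simpa [edist_dist, Real.dist_eq, abs_sub_comm, add_comm, sub_eq_add_neg] using hK (-x) (-y)
  · exact ((h.continuous_position i).comp continuous_neg).measurable

theorem memLp_ite {s : Set ℝ} [DecidablePred (· ∈ s)] (hs : MeasurableSet s) {f g : ℝ → ℝ}
    (hf : MemLp f 2 volume) (hg : MemLp g 2 volume) :
    MemLp (fun τ => if τ ∈ s then f τ else g τ) 2 volume :=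
  MemLp.piecewise hs (hf.restrict s) (hg.restrict sᶜ)

theorem memLp_negProfile (h : IsSpeeds lam)
    (hy0 : ∀ i, MemLp (y0 i) 2 (volume.restrict (Ioo 0 1))) (i : Fin m) :
    MemLp (negProfile lam N y0 i) 2 volume := by
  induction i using WellFoundedGT.induction with
  | ind i ih =>
    rw [funext (negProfile_eq N y0 i)]
    exact memLp_ite (measurableSet_Iic (a := travelTime lam (Sum.inl i)))
      (memLp_initialProfile h (hy0 _))
      (memLp_finsetSum _ fun k hk => (ih k (Finset.mem_Ioi.1 hk)).const_mul _).neg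

theorem memLp_profile (h : IsSpeeds lam)
    (hy0 : ∀ i, MemLp (y0 i) 2 (volume.restrict (Ioo 0 1))) (i : Idx m p) :
    MemLp (profile lam Q N y0 i) 2 volume := by
  cases i with
  | inl i => exact memLp_negProfile h hy0 i
  | inr i =>
    exact memLp_ite (measurableSet_Ioi (a := (0 : ℝ)))
      (memLp_finsetSum _ fun j _ => (memLp_negProfile h hy0 j).const_mul _)
      (memLp_initialProfile h (hy0 _))

/-- The feedback law, evaluated on the explicit solution. -/
theorem feedback_closedLoop (h : IsSpeeds lam) (i : Fin m) (t : ℝ) :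
    (feedback lam U i fun k => closedLoop lam Q U⁻¹ y0 k t) =
      -∑ k ∈ Finset.Ioi i, U⁻¹ i k *
        negProfile lam U⁻¹ y0 k (t - signedTime lam (Sum.inl i) 1) := by
  simp only [feedback, closedLoop, profile, h.signedTime_zeta]

/-- The label passes its threshold, `T_i` or `0`, exactly when the entry time is positive, so the
branches of `profile` and `datum` match pointwise. -/
theorem closedLoop_eq_datum (h : IsSpeeds lam) (i : Idx m p) {t x : ℝ}
    (ht : 0 ≤ t) (hx : x ∈ Icc (0 : ℝ) 1) :
    closedLoop lam Q U⁻¹ y0 i t x = datum lam Q y0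
      (fun i t => feedback lam U i fun k => closedLoop lam Q U⁻¹ y0 k t)
      (closedLoop lam Q U⁻¹ y0) i t x := by
  have hinit : ∀ i : Idx m p, position lam i (-(t - signedTime lam i x)) ∈ Icc (0 : ℝ) 1 →
      initialProfile lam y0 i (t - signedTime lam i x) =
        y0 i (characteristic lam i 0 t x) := by
    intro i hi
    rw [initialProfile, indicator_of_mem hi, h.characteristic_zero]
  cases i with
  | inl i =>
    simp only [datum, h.entryTime_inl, feedback_closedLoop h, add_sub_cancel_right]
    have hlt : t - signedTime lam (Sum.inl i) x ≤ travelTime lam (Sum.inl i) ↔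
        ¬ 0 < t - signedTime lam (Sum.inl i) x + signedTime lam (Sum.inl i) 1 := by
      rw [travelTime_inl, not_lt]
      constructor <;> intro <;> linarith
    rw [closedLoop, profile, negProfile_eq]
    simp only [hlt]
    split_ifs with hc
    · rfl
    · refine hinit _ ?_
      have hx0 := (h.signedTime_strictAnti i).antitone hx.1
      rw [signedTime_zero] at hx0
      constructor
      · rw [← (h.signedTime_strictAnti i).le_iff_ge, h.signedTime_position, signedTime_zero]
        linarith
      · rw [← (h.signedTime_strictAnti i).le_iff_ge, h.signedTime_position]
        linarith
  | inr i =>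
    simp only [datum, entryTime_inr]
    simp only [closedLoop, profile, signedTime_zero, sub_zero]
    split_ifs with hc
    · rfl
    · refine hinit _ ?_
      have hx1 := (h.signedTime_strictMono i).monotone hx.2
      constructor
      · rw [← (h.signedTime_strictMono i).le_iff_le, h.signedTime_position, signedTime_zero]
        linarith
      · rw [← (h.signedTime_strictMono i).le_iff_le, h.signedTime_position]
        linarith

/-- Both continuity requirements are instances of `l2ContinuousOn_profile`, with the roles of `t`
and `x` exchanged. -/
theorem isClosedLoopSolution_closedLoop (h : IsSpeeds lam)
    (hy0 : ∀ i, MemLp (y0 i) 2 (volume.restrict (Ioo 0 1))) (S : ℝ) :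
    IsClosedLoopSolution lam Q (feedback lam U) S y0 (closedLoop lam Q U⁻¹ y0) where
  memLp_initial := hy0
  memLp_control i := by
    have hk : ∀ k, MemLp (fun t => U⁻¹ i k *
        negProfile lam U⁻¹ y0 k (t - signedTime lam (Sum.inl i) 1)) 2 volume := fun k =>
      ((memLp_negProfile h hy0 k).comp_measurePreserving
        (measurePreserving_sub_right volume _)).const_mul _
    rw [funext (feedback_closedLoop h i)]
    exact ((memLp_finsetSum (Finset.Ioi i) fun k _ => hk k).neg).restrict _
  measurable i := by
    have hq := h.quasiMeasurePreserving_label i 0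
    simp only [add_zero] at hq
    exact ((memLp_profile h hy0 i).1.comp_quasiMeasurePreserving hq).restrict
  continuous_time i := by
    obtain ⟨K, hK⟩ := h.exists_antilipschitz_signedTime i
    have hneg : AntilipschitzWith K fun x => -signedTime lam i x := by
      intro x y
      simpa [edist_dist, Real.dist_eq, abs_sub_comm, add_comm, sub_eq_add_neg] using hK x y
    have : L2ContinuousOn (Icc 0 S) (Ioo 0 1) fun t x =>
        profile lam Q U⁻¹ y0 i (t + -signedTime lam i x) :=
      l2ContinuousOn_profile (memLp_profile h hy0 i) continuous_id hneg
        (h.continuous_signedTime i).neg.measurable _ _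
    simpa only [closedLoop, ← sub_eq_add_neg] using this
  continuous_space i := by
    have : L2ContinuousOn (Icc 0 1) (Ioo 0 S) fun x t =>
        profile lam Q U⁻¹ y0 i (-signedTime lam i x + t) :=
      l2ContinuousOn_profile (memLp_profile h hy0 i) (h.continuous_signedTime i).neg
        AntilipschitzWith.id measurable_id _ _
    simpa only [closedLoop, neg_add_eq_sub] using this
  equation i := by
    filter_upwards [ae_restrict_mem (measurableSet_Ioo.prod measurableSet_Ioo)] with z hz
    exact closedLoop_eq_datum h i hz.1.1.le ⟨hz.2.1.le, hz.2.2.le⟩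

/-- The feedback law cancels the components of `U⁻¹ y_-(·, 0)` one after the other. -/
theorem sum_mul_negProfile_eq_zero (hN : IsUnitUpper N) {i : Fin m} {τ : ℝ}
    (hτ : travelTime lam (Sum.inl i) < τ) : ∑ k, N i k * negProfile lam N y0 k τ = 0 := by
  have hsplit : ∑ k, N i k * negProfile lam N y0 k τ =
      ∑ k ∈ Finset.Ici i, N i k * negProfile lam N y0 k τ := by
    refine (Finset.sum_subset (Finset.subset_univ _) fun k _ hk => ?_).symm
    rw [Finset.mem_Ici, not_le] at hk
    rw [hN.1 (show id k < id i from hk), zero_mul]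
  rw [hsplit, ← Finset.Ioi_insert, Finset.sum_insert (by simp), hN.2, one_mul, negProfile_eq,
    if_neg hτ.not_ge, neg_add_cancel]

/-- In `Q = L⁻¹ Q⁰ U⁻¹`, triangularity of `L⁻¹` restricts row `i` to `r ≤ i`, where `T_{m+r} ≥
T_{m+i}`; each surviving entry of `Q⁰` then meets a component of `U⁻¹ f` already cancelled. -/
theorem sum_coupling_negProfile_eq_zero (h : IsSpeeds lam) {L : Matrix (Fin p) (Fin p) ℝ}
    {Q0 : Matrix (Fin p) (Fin m) ℝ} (hLCU : IsLCU Q L Q0 U) {T : ℝ}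
    (hT : ∀ r c, Q0 r c ≠ 0 →
      travelTime lam (Sum.inr r) + travelTime lam (Sum.inl c) ≤ T)
    {i : Fin p} {τ : ℝ} (hτ : T < τ + travelTime lam (Sum.inr i)) :
    ∑ j, Q i j * negProfile lam U⁻¹ y0 j τ = 0 := by
  obtain ⟨hU, hUU⟩ := hLCU.isUnitUpper.inv
  obtain ⟨hL, hLL⟩ := hLCU.isUnitLower.inv
  let f : Fin m → ℝ := fun j => negProfile lam U⁻¹ y0 j τ
  have hQ : Q = L⁻¹ * (Q0 * U⁻¹) := by
    rw [← hLCU.mul_eq, Matrix.mul_assoc, hUU, Matrix.mul_one, ← Matrix.mul_assoc, hLL,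
      Matrix.one_mul]
  change (Q.mulVec f) i = 0
  rw [hQ, ← Matrix.mulVec_mulVec, ← Matrix.mulVec_mulVec]
  change ∑ r, L⁻¹ i r * (Q0.mulVec (U⁻¹.mulVec f)) r = 0
  refine Finset.sum_eq_zero fun r _ => ?_
  rcases lt_or_ge i r with hir | hri
  · rw [hL (show OrderDual.toDual r < OrderDual.toDual i from hir), zero_mul]
  · refine mul_eq_zero_of_right _ ?_
    change ∑ c, Q0 r c * (U⁻¹.mulVec f) c = 0
    refine Finset.sum_eq_zero fun c _ => ?_
    by_cases hrc : Q0 r c = 0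
    · rw [hrc, zero_mul]
    · refine mul_eq_zero_of_right _ (sum_mul_negProfile_eq_zero hU ?_)
      have := hT r c hrc
      have := h.travelTime_inr_anti hri
      simp only at this
      linarith

theorem closedLoop_eq_zero (h : IsSpeeds lam) (hm : 1 ≤ m) (hp : 1 ≤ p) {T : ℝ}
    (hT : TimeCondition hm hp lam Q T) {L : Matrix (Fin p) (Fin p) ℝ}
    {Q0 : Matrix (Fin p) (Fin m) ℝ} (hLCU : IsLCU Q L Q0 U) (i : Idx m p) {t x : ℝ}
    (ht : T ≤ t) (hx : x ∈ Ioo (0 : ℝ) 1) : closedLoop lam Q U⁻¹ y0 i t x = 0 := by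
  cases i with
  | inl i =>
    obtain ⟨hU, hUU⟩ := hLCU.isUnitUpper.inv
    let f : Fin m → ℝ := fun j =>
      negProfile lam U⁻¹ y0 j (t - signedTime lam (Sum.inl i) x)
    have hf : U⁻¹.mulVec f = 0 := by
      funext k
      refine sum_mul_negProfile_eq_zero hU ?_
      have hk : k ≤ ⟨m - 1, Nat.sub_lt hm Nat.one_pos⟩ :=
        Fin.le_iff_val_le_val.2 (Nat.le_sub_one_of_lt k.2)
      have h1 := h.travelTime_inl_mono hk
      -- Since `x > 0`, the label is strictly larger than `t`, so `t = T` is covered despite the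
      -- strict inequality in `sum_mul_negProfile_eq_zero`.
      have h2 := h.signedTime_strictAnti i hx.1
      rw [signedTime_zero] at h2
      have h3 := hT.2.2
      simp only at h1
      linarith
    have : f = 0 := by
      rw [← Matrix.one_mulVec f, ← hUU, ← Matrix.mulVec_mulVec, hf, Matrix.mulVec_zero]
    exact congrFun this i
  | inr i =>
    -- Since `x < 1`, the label exceeds `t - T_{m+i}`: it is positive because `T ≥ T_{m+1}`, and
    -- late enough for the coupling to vanish.
    have h1 := h.signedTime_strictMono i hx.2
    rw [← travelTime_inr] at h1
    have h2 := h.travelTime_inr_anti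
      (show (⟨0, hp⟩ : Fin p) ≤ i from Fin.le_iff_val_le_val.2 (Nat.zero_le _))
    simp only at h2
    have h3 := hT.2.1
    have h4 : 0 < t - signedTime lam (Sum.inr i) x := by linarith
    simp only [closedLoop, profile, if_pos h4]
    exact sum_coupling_negProfile_eq_zero h hLCU (hT.1 L Q0 U hLCU) (by linarith)

end ClosedLoop

/-! ### Uniqueness of the closed-loop solution. -/

section Uniqueness

variable {Q : Matrix (Fin p) (Fin m) ℝ} {U : Matrix (Fin m) (Fin m) ℝ} {y0 : Idx m p → ℝ → ℝ}
  {S : ℝ} {u v : Fin m → ℝ → ℝ} {y z : Idx m p → ℝ → ℝ → ℝ}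

/-- Fubini gives the equality for almost every `x`, and continuity in `x` extends it to every `x`,
including the boundary and the points `ζ_{ik}(1)`. -/
theorem IsSolution.ae_eq_trace (hy : IsSolution lam Q S y0 u y) (hz : IsSolution lam Q S y0 v z)
    {i : Idx m p} (hi : ∀ᵐ q : ℝ × ℝ ∂(volume.restrict (Ioo 0 S ×ˢ Ioo 0 1)),
      y i q.1 q.2 = z i q.1 q.2) {x : ℝ} (hx : x ∈ Icc (0 : ℝ) 1) :
    ∀ᵐ t ∂(volume.restrict (Ioo 0 S)), y i t x = z i t x := by
  refine (hy.continuous_space i).ae_eq zero_lt_one (hz.continuous_space i) ?_ x hx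
  rw [Measure.volume_eq_prod, ← Measure.prod_restrict] at hi
  exact Measure.ae_ae_of_ae_prod (Measure.measurePreserving_swap.quasiMeasurePreserving.ae hi)

theorem IsSolution.ae_eq_slice (hS : 0 < S) (hy : IsSolution lam Q S y0 u y)
    (hz : IsSolution lam Q S y0 v z) {i : Idx m p}
    (hi : ∀ᵐ q : ℝ × ℝ ∂(volume.restrict (Ioo 0 S ×ˢ Ioo 0 1)),
      y i q.1 q.2 = z i q.1 q.2) {t : ℝ} (ht : t ∈ Icc 0 S) :
    y i t =ᵐ[volume.restrict (Ioo 0 1)] z i t := by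
  refine (hy.continuous_time i).ae_eq hS (hz.continuous_time i) ?_ t ht
  rw [Measure.volume_eq_prod, ← Measure.prod_restrict] at hi
  exact Measure.ae_ae_of_ae_prod hi

/-- A property of almost every time holds at almost every entry time. -/
theorem ae_entryTime (h : IsSpeeds lam) (i : Idx m p) {P : ℝ → Prop}
    (hP : ∀ᵐ t ∂(volume.restrict (Ioo 0 S)), P t) :
    ∀ᵐ q : ℝ × ℝ ∂(volume.restrict (Ioo 0 S ×ˢ Ioo 0 1)),
      0 < entryTime lam i q.1 q.2 → P (entryTime lam i q.1 q.2) := by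
  rw [ae_restrict_iff' measurableSet_Ioo] at hP
  -- An interior point is reached strictly after entry, so only times before `S` are involved.
  have hlt : ∀ q ∈ Ioo 0 S ×ˢ Ioo (0 : ℝ) 1, entryTime lam i q.1 q.2 < S := by
    intro q hq
    cases i with
    | inl i =>
      have := h.signedTime_strictAnti i hq.2.2
      have := hq.1.2
      rw [h.entryTime_inl]
      linarith
    | inr i =>
      have := h.signedTime_strictMono i hq.2.1
      have := hq.1.2
      rw [signedTime_zero] at *
      rw [entryTime_inr]
      linarith
  have hq : ∀ᵐ q : ℝ × ℝ, entryTime lam i q.1 q.2 ∈ Ioo 0 S → P (entryTime lam i q.1 q.2) := by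
    cases i with
    | inl i =>
      simp only [h.entryTime_inl]
      exact (h.quasiMeasurePreserving_label (Sum.inl i) _).ae hP
    | inr i =>
      have := (h.quasiMeasurePreserving_label (Sum.inr i) 0).ae hP
      simpa only [entryTime_inr, add_zero] using this
  filter_upwards [ae_restrict_of_ae hq,
    ae_restrict_mem (measurableSet_Ioo.prod measurableSet_Ioo)] with q h1 h2 h3
  exact h1 ⟨h3, hlt q h2⟩

/-- Descending induction: the control `u_i` reads only components `k > i`, whose traces already
agree, and equal controls give equal data along characteristics. -/
theorem IsClosedLoopSolution.ae_eq_neg (h : IsSpeeds lam)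
    (hy : IsClosedLoopSolution lam Q (feedback lam U) S y0 y)
    (hz : IsClosedLoopSolution lam Q (feedback lam U) S y0 z) (i : Fin m) :
    ∀ᵐ q : ℝ × ℝ ∂(volume.restrict (Ioo 0 S ×ˢ Ioo 0 1)),
      y (Sum.inl i) q.1 q.2 = z (Sum.inl i) q.1 q.2 := by
  induction i using WellFoundedGT.induction with
  | ind i ih =>
    have hcontrol : ∀ᵐ t ∂(volume.restrict (Ioo 0 S)),
        (feedback lam U i fun k => y k t) = feedback lam U i fun k => z k t := by
      have : ∀ᵐ t ∂(volume.restrict (Ioo 0 S)), ∀ k : Fin m, i < k →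
          y (Sum.inl k) t (zeta lam (Sum.inl i) (Sum.inl k) 1) =
            z (Sum.inl k) t (zeta lam (Sum.inl i) (Sum.inl k) 1) := by
        rw [ae_all_iff]
        intro k
        by_cases hk : i < k
        · filter_upwards [IsSolution.ae_eq_trace hy hz (ih k hk) (h.zeta_one_mem hk.le)]
            with t ht _ using ht
        · exact Eventually.of_forall fun t hk' => absurd hk' hk
      filter_upwards [this] with t ht
      simp only [feedback]
      congr 1
      exact Finset.sum_congr rfl fun k hk => by rw [ht k (Finset.mem_Ioi.1 hk)]
    filter_upwards [hy.equation (Sum.inl i), hz.equation (Sum.inl i),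
      ae_entryTime h (Sum.inl i) hcontrol] with q h1 h2 h3
    rw [h1, h2]
    simp only [datum]
    split_ifs with hc
    · exact h3 hc
    · rfl

theorem IsClosedLoopSolution.ae_eq (h : IsSpeeds lam)
    (hy : IsClosedLoopSolution lam Q (feedback lam U) S y0 y)
    (hz : IsClosedLoopSolution lam Q (feedback lam U) S y0 z) (i : Idx m p) :
    ∀ᵐ q : ℝ × ℝ ∂(volume.restrict (Ioo 0 S ×ˢ Ioo 0 1)), y i q.1 q.2 = z i q.1 q.2 := by
  cases i with
  | inl i => exact hy.ae_eq_neg h hz i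
  | inr i =>
    have htrace : ∀ᵐ t ∂(volume.restrict (Ioo 0 S)), ∀ j : Fin m,
        y (Sum.inl j) t 0 = z (Sum.inl j) t 0 :=
      ae_all_iff.2 fun j => IsSolution.ae_eq_trace hy hz (hy.ae_eq_neg h hz j)
        (left_mem_Icc.2 zero_le_one)
    filter_upwards [hy.equation (Sum.inr i), hz.equation (Sum.inr i),
      ae_entryTime h (Sum.inr i) htrace] with q h1 h2 h3
    rw [h1, h2]
    simp only [datum]
    split_ifs with hc
    · exact Finset.sum_congr rfl fun j _ => by rw [h3 hc j]
    · rfl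

theorem IsClosedLoopSolution.slice_ae_eq (h : IsSpeeds lam) (hS : 0 < S)
    (hy : IsClosedLoopSolution lam Q (feedback lam U) S y0 y)
    (hz : IsClosedLoopSolution lam Q (feedback lam U) S y0 z) {t : ℝ} (ht : t ∈ Icc 0 S)
    (i : Idx m p) : y i t =ᵐ[volume.restrict (Ioo 0 1)] z i t :=
  IsSolution.ae_eq_slice hS hy hz (hy.ae_eq h hz i) ht

end Uniqueness

theorem IsLCU.stabilizesInTime (h : IsSpeeds lam) (hm : 1 ≤ m) (hp : 1 ≤ p)
    {Q : Matrix (Fin p) (Fin m) ℝ} {T : ℝ} (hT : TimeCondition hm hp lam Q T)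
    {L : Matrix (Fin p) (Fin p) ℝ} {Q0 : Matrix (Fin p) (Fin m) ℝ}
    {U : Matrix (Fin m) (Fin m) ℝ} (hLCU : IsLCU Q L Q0 U) :
    StabilizesInTime lam Q (feedback lam U) T := by
  intro y0 hy0 S hS
  have hsol := isClosedLoopSolution_closedLoop (Q := Q) (U := U) h hy0 S
  refine ⟨⟨_, hsol⟩, fun y z hy hz t ht i => hy.slice_ae_eq h hS hz ht i,
    fun y hy t ht i => ?_⟩
  -- Needed to place `[T, S]` inside `[0, S]`, where any solution coincides with the explicit one.
  have hT0 : 0 ≤ T := (h.travelTime_inl_pos _).le.trans hT.2.2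
  filter_upwards [hy.slice_ae_eq h hS hsol ⟨hT0.trans ht.1, ht.2⟩ i,
    ae_restrict_mem measurableSet_Ioo] with x hx hmem
  rw [hx]
  exact closedLoop_eq_zero h hm hp hT hLCU i ht.1 hmem

end Hyperbolic

theorem proposition4p3 {m p : ℕ} (hm : 1 ≤ m) (hp : 1 ≤ p)
    (lam : Hyperbolic.Idx m p → ℝ → ℝ) (hlam : Hyperbolic.IsSpeeds lam)
    (Q : Matrix (Fin p) (Fin m) ℝ) (T : ℝ)
    (hT : Hyperbolic.TimeCondition hm hp lam Q T) :
    (∃ L Q0 U, Hyperbolic.IsLCU Q L Q0 U) ∧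
    ∀ L Q0 U, Hyperbolic.IsLCU Q L Q0 U →
      Hyperbolic.StabilizesInTime lam Q (Hyperbolic.feedback lam U) T := by
  exact ⟨Hyperbolic.exists_isLCU Q, fun _ _ _ hLCU => hLCU.stabilizesInTime hlam hm hp hT⟩
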